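/- All graphs are finite and simple. For $d\in\mathbb N=\{0,1,2,\dots\}$, the $d$th power $G^d$ of a graph $G$ has the same vertex set as $G$, two distinct vertices being adjacent in $G^d$ if and only if their distance in $G$ is at most $d$; for a class of graphs $\mathcal C$ put $\mathcal C^d=\{G^d : G\in\mathcal C\}$. A graph $H$ is a depth-$r$ minor of $G$ if it can be obtained from a subgraph of $G$ by contracting pairwise disjoint connected subgraphs of radius at most $r$; $\nabla_r(G)$ is the maximum of $|E(H)|/|V(H)|$ over the depth-$r$ minors $H$ of $G$ (the ratio is read as $0$ for the graph without vertices). A class $\mathcal C$ has bounded expansion if $\sup_{G\in\mathcal C}\nabla_r(G)<\infty$ for every $r\in\mathbb N$. A clustering of a graph $H$ is a partition $\mathcal X$ of $V(H)$ into non-empty blocks each of which is a clique in $H$; the quotient graph $H/\mathcal X$ has the blocks of $\mathcal X$ as its vertices, two distinct blocks $A,B$ being adjacent if and only if some $u\in A$ and $v\in B$ are adjacent in $H$. Let $\mathcal C$ be a class of graphs with bounded expansion and let $d\in\mathbb N$. Then one can choose for every graph $H\in\mathcal C^d$ a clustering $\mathcal X_H$ of $H$ such that the class $\{H/\mathcal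 X_H : H\in\mathcal C^d\}$ also has bounded expansion. -/

import Mathlib

open scoped ENNReal

universe u

/-- A finite simple graph together with its vertex set. -/
structure FinGraph : Type (u + 1) where
  V : Type u
  [finite : Finite V]
  graph : SimpleGraph V

attribute [instance] FinGraph.finite

namespace FinGraph

/-- The `d`th power of `G`: distinct vertices are adjacent iff their distance in `G` is at most `d`
(the distance is `⊤` between different components). -/
def powerGraph {V : Type u} (G : SimpleGraph V) (d : ℕ) : SimpleGraph V where
  Adj x y := x ≠ y ∧ G.edist x y ≤ d
  symm := ⟨fun x y h => ⟨h.1.symm, by rw [SimpleGraph.edist_comm]; exact h.2⟩⟩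
  loopless := ⟨fun _ h => h.1 rfl⟩

/-- The `d`th power of `G`, as a finite graph. -/
def power (G : FinGraph.{u}) (d : ℕ) : FinGraph.{u} where
  V := G.V
  graph := powerGraph G.graph d

/-- The class of `d`th powers of the graphs of a class. -/
def powerClass (C : Set FinGraph.{u}) (d : ℕ) : Set FinGraph.{u} :=
  (fun G => G.power d) '' C

/-- `H` is a depth-`r` minor of `G`: the vertices of `H` are represented by pairwise disjoint
connected subgraphs of `G` of radius at most `r`, and any two vertices adjacent in `H` are
represented by subgraphs joined by an edge of `G`. -/
def IsDepthMinor (r : ℕ) (H G : FinGraph.{u}) : Prop :=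
  ∃ branch : H.V → G.graph.Subgraph,
    (∀ a, (branch a).coe.Connected ∧ (branch a).coe.radius ≤ r) ∧
    (∀ a b, a ≠ b → Disjoint (branch a).verts (branch b).verts) ∧
    (∀ a b, H.graph.Adj a b →
      ∃ x ∈ (branch a).verts, ∃ y ∈ (branch b).verts, G.graph.Adj x y)

/-- Number of edges divided by number of vertices; the value is `0` for the graph without
vertices. -/
noncomputable def edgeDensity (H : FinGraph.{u}) : ℝ≥0∞ :=
  (H.graph.edgeSet.ncard : ℝ≥0∞) / (Nat.card H.V : ℝ≥0∞)

/-- `∇_r(G)`: the largest edge density of a depth-`r` minor of `G`. -/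
noncomputable def nabla (r : ℕ) (G : FinGraph.{u}) : ℝ≥0∞ :=
  ⨆ (H : FinGraph.{u}) (_ : IsDepthMinor r H G), H.edgeDensity

/-- A class of graphs has bounded expansion if `sup_{G ∈ C} ∇_r(G)` is finite for every `r`. -/
def BoundedExpansion (C : Set FinGraph.{u}) : Prop :=
  ∀ r : ℕ, (⨆ G ∈ C, nabla r G) < ⊤

/-- A partition of the vertex set of `H` into cliques. -/
structure Clustering {V : Type u} (H : SimpleGraph V) where
  blocks : Set (Set V)
  isPartition : Setoid.IsPartition blocks
  isClique : ∀ A ∈ blocks, H.IsClique A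

/-- The quotient graph: its vertices are the blocks, and two different blocks are adjacent iff
some edge of `H` joins them. -/
def Clustering.quotientGraph {V : Type u} {H : SimpleGraph V} (X : Clustering H) :
    SimpleGraph X.blocks where
  Adj A B := A ≠ B ∧ ∃ x ∈ A.1, ∃ y ∈ B.1, H.Adj x y
  symm := ⟨fun _ _ ⟨hne, x, hx, y, hy, h⟩ => ⟨hne.symm, y, hy, x, hx, h.symm⟩⟩
  loopless := ⟨fun _ h => h.1 rfl⟩

/-- The quotient graph of a finite graph, as a finite graph. -/
def quotient (H : FinGraph.{u}) (X : Clustering H.graph) : FinGraph.{u} where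
  V := X.blocks
  graph := X.quotientGraph

end FinGraph

/-!
A class of bounded expansion has bounded weak colouring numbers: each of its graphs `G` has a
ranking `π` of its vertices for which few vertices are weakly reachable from any given one. Send
each vertex of `G` to the vertex of least rank in its ball of radius `k = ⌊d/2⌋`. Vertices with the
same image are at distance at most `2 * k ≤ d`, so the fibres form a clustering of `G^d`. Represent
the fibre over `u` by the set of vertices from which `u` is weakly `2 * k`-reachable: it is spanned
by walks of length at most `2 * k` to `u`, it contains the balls around the members of the fibre
(whence adjacent fibres have intersecting or touching sets), and each vertex lies in few of these
sets.

The quotient is thus a shallow minor of `G` with bounded congestion. Such minors compose, and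
orienting each edge of one towards the endpoint whose representing set has the smaller minimal rank
bounds its density by weak colouring numbers of `G`.

The ranking is chosen from the top down: among the set `S` of vertices not yet ranked one needs a
`v` that few vertices separate from `S \ {v}` along walks of length at most `r`. Grow disjoint sets
of radius at most `2 * r` around the vertices of `S`, always by a short walk that makes two sets
touch for the first time. Each step pays for its new vertices with a new edge of a shallow minor, so
the sets stay small in total; when no step is possible, the balls of radius `r` avoiding the sets
are disjoint around the members of an independent set of that minor, and sparsity, applied to the
minor formed by these balls and the single vertices of the sets, yields a `v` whose ball has few
neighbours in the sets.
-/

namespace FinGraph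

section Reach

variable {V : Type*} {G : SimpleGraph V} {A A' : Set V} {m n : ℕ} {x y z : V}

/-- `y` can be reached from `x` by a walk of length at most `n` that stays inside `A`. -/
def ReachIn (G : SimpleGraph V) (A : Set V) (n : ℕ) (x y : V) : Prop :=
  ∃ p : G.Walk x y, p.length ≤ n ∧ ∀ z ∈ p.support, z ∈ A

theorem ReachIn.refl (hx : x ∈ A) (n : ℕ) : ReachIn G A n x x :=
  ⟨.nil, by simp, by simpa using hx⟩

theorem ReachIn.mono (h : ReachIn G A m x y) (hA : A ⊆ A') (hmn : m ≤ n) : ReachIn G A' n x y := by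
  obtain ⟨p, hp, hpA⟩ := h
  exact ⟨p, hp.trans hmn, fun z hz => hA (hpA z hz)⟩

theorem ReachIn.symm (h : ReachIn G A n x y) : ReachIn G A n y x := by
  obtain ⟨p, hp, hpA⟩ := h
  exact ⟨p.reverse, by simpa using hp, fun z hz => hpA z (by simpa using hz)⟩

theorem ReachIn.trans (h : ReachIn G A m x y) (h' : ReachIn G A n y z) :
    ReachIn G A (m + n) x z := by
  obtain ⟨p, hp, hpA⟩ := h
  obtain ⟨q, hq, hqA⟩ := h'
  refine ⟨p.append q, by rw [SimpleGraph.Walk.length_append]; omega, fun w hw => ?_⟩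
  exact ((SimpleGraph.Walk.mem_support_append_iff p q).1 hw).elim (hpA w) (hqA w)

theorem ReachIn.of_adj (h : G.Adj x y) (hx : x ∈ A) (hy : y ∈ A) : ReachIn G A 1 x y :=
  ⟨h.toWalk, by simp, by simp [hx, hy]⟩

theorem ReachIn.of_edist_le_one (h : G.edist x y ≤ 1) (hx : x ∈ A) (hy : y ∈ A) :
    ReachIn G A 1 x y := by
  rcases SimpleGraph.edist_le_one_iff_adj_or_eq.1 h with hxy | rfl
  exacts [.of_adj hxy hx hy, .refl hx 1]

theorem ReachIn.left_mem (h : ReachIn G A n x y) : x ∈ A := by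
  obtain ⟨p, -, hpA⟩ := h
  exact hpA x p.start_mem_support

theorem ReachIn.right_mem (h : ReachIn G A n x y) : y ∈ A :=
  h.symm.left_mem

theorem ReachIn.reachIn_setOf_reachIn (h : ReachIn G A n x y) :
    ReachIn G {z | ReachIn G A n x z} n x y := by
  classical
  obtain ⟨p, hp, hpA⟩ := h
  exact ⟨p, hp, fun z hz => ⟨p.takeUntil z hz, (p.length_takeUntil_le_length hz).trans hp,
    fun w hw => hpA w (p.support_takeUntil_subset_support hz hw)⟩⟩

theorem ReachIn.exists_subset_ncard_diff_le [Finite V] (h : ReachIn G A n x y) :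
    ∃ P ⊆ A, y ∈ P ∧ (∀ z ∈ P, ReachIn G P n x z) ∧ (P \ {x}).ncard ≤ n := by
  classical
  obtain ⟨p, hp, hpA⟩ := h
  refine ⟨{z | z ∈ p.support}, hpA, p.end_mem_support, fun z hz => ⟨p.takeUntil z hz,
    (p.length_takeUntil_le_length hz).trans hp, fun w hw =>
      p.support_takeUntil_subset_support hz hw⟩, ?_⟩
  have htail : {z | z ∈ p.support} \ {x} ⊆ (p.support.tail.toFinset : Set V) := by
    rintro z ⟨hz, hzx⟩
    simpa using (p.mem_support_iff.1 hz).resolve_left hzx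
  calc ({z | z ∈ p.support} \ {x}).ncard ≤ p.support.tail.toFinset.card :=
        (Set.ncard_le_ncard htail (Set.toFinite _)).trans (Set.ncard_coe_finset _).le
    _ ≤ p.support.tail.length := List.toFinset_card_le _
    _ ≤ n := by simpa using hp

theorem exists_first_exit (p : G.Walk x y) (hx : x ∈ A) (hy : y ∉ A) :
    ∃ n u w, n + 1 ≤ p.length ∧ ReachIn G A n x u ∧ G.Adj u w ∧ w ∉ A ∧ w ∈ p.support := by
  induction p with
  | nil => exact absurd hx hy
  | @cons a b c hab q ih =>
    by_cases hb : b ∈ A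
    · obtain ⟨n, u, w, hn, hbu, huw, hw, hwq⟩ := ih hb hy
      exact ⟨n + 1, u, w, by simpa using hn,
        ((ReachIn.of_adj hab hx hb).trans hbu).mono subset_rfl (by omega), huw, hw, by simp [hwq]⟩
    · exact ⟨0, a, b, by simp, .refl hx 0, hab, hb, by simp⟩

theorem exists_walk_length_le_of_edist_le (h : G.edist x y ≤ n) :
    ∃ p : G.Walk x y, p.length ≤ n := by
  obtain ⟨p, hp⟩ := SimpleGraph.exists_walk_of_edist_ne_top
    (ne_top_of_le_ne_top (ENat.natCast_ne_top n) h)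
  exact ⟨p, by exact_mod_cast hp.le.trans h⟩

theorem ReachIn.edist_le (h : ReachIn G A n x y) : G.edist x y ≤ n := by
  obtain ⟨p, hp, -⟩ := h
  exact p.edist_le.trans (by exact_mod_cast hp)

theorem reachIn_ball_of_edist_le (h : G.edist x y ≤ n) :
    ReachIn G {z | G.edist x z ≤ n} n x y := by
  obtain ⟨p, hp⟩ := exists_walk_length_le_of_edist_le h
  have hxy : ReachIn G Set.univ n x y := ⟨p, hp, fun z _ => Set.mem_univ z⟩
  exact hxy.reachIn_setOf_reachIn.mono (fun z hz => ReachIn.edist_le hz) le_rfl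

theorem exists_edist_le_edist_le (h : G.edist x z ≤ (m + n : ℕ)) :
    ∃ y, G.edist x y ≤ m ∧ G.edist y z ≤ n := by
  obtain ⟨p, hp⟩ := exists_walk_length_le_of_edist_le h
  refine ⟨p.getVert m, (p.take m).edist_le.trans ?_, (p.drop m).edist_le.trans ?_⟩
  · simp
  · rw [SimpleGraph.Walk.drop_length]
    norm_cast
    omega

end Reach

section Counting

theorem ncard_biUnion_le_mul {ι V : Type*} {s : Set ι} (hs : s.Finite) {f : ι → Set V} {n : ℕ}
    (hf : ∀ i ∈ s, (f i).ncard ≤ n) : (⋃ i ∈ s, f i).ncard ≤ s.ncard * n := by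
  refine (hs.ncard_biUnion_le f).trans ?_
  rw [finsum_mem_eq_finite_toFinset_sum _ hs, Set.ncard_eq_toFinset_card s hs, ← smul_eq_mul]
  exact Finset.sum_le_card_nsmul _ _ _ fun i hi => hf i (hs.mem_toFinset.1 hi)

theorem ncard_edgeSet_le_of_orientation {V : Type*} [Finite V] {H : SimpleGraph V}
    {R : V → V → Prop} {n : ℕ} (hR : ∀ a b, H.Adj a b → R a b ∨ R b a)
    (hn : ∀ a, {b | R a b}.ncard ≤ n) : H.edgeSet.ncard ≤ n * Nat.card V := by
  have hcover : H.edgeSet ⊆ ⋃ a ∈ (Set.univ : Set V), (fun b => s(a, b)) '' {b | R a b} := by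
    intro e
    induction e using Sym2.ind with
    | _ a b =>
      intro hab
      simp only [Set.mem_iUnion]
      rcases hR a b hab with h | h
      exacts [⟨a, trivial, b, h, rfl⟩, ⟨b, trivial, a, h, Sym2.eq_swap⟩]
  calc H.edgeSet.ncard ≤ _ := Set.ncard_le_ncard hcover (Set.toFinite _)
    _ ≤ (Set.univ : Set V).ncard * n := ncard_biUnion_le_mul (Set.toFinite _) fun a _ =>
      (Set.ncard_image_le (Set.toFinite _)).trans (hn a)
    _ = n * Nat.card V := by rw [Set.ncard_univ, mul_comm]

end Counting

section IndependentSets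

variable {V : Type*} [Fintype V] (G : SimpleGraph V) [DecidableRel G.Adj]

theorem exists_isIndepSet_subset_card_le {L : Finset V} {D : ℕ} (hL : ∀ v ∈ L, G.degree v ≤ D) :
    ∃ I ⊆ L, G.IsIndepSet (I : Set V) ∧ L.card ≤ I.card * (D + 1) := by
  classical
  obtain ⟨I, hI⟩ := (Set.toFinite {I : Finset V | I ⊆ L ∧ G.IsIndepSet (I : Set V)}).exists_maximal
    ⟨∅, by simp⟩
  obtain ⟨hIL, hind⟩ := hI.prop
  have hcover : L ⊆ I.biUnion fun v => insert v (G.neighborFinset v) := by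
    intro x hx
    by_contra! hxI
    simp only [Finset.mem_biUnion, Finset.mem_insert, SimpleGraph.mem_neighborFinset, not_exists,
      not_and, not_or] at hxI
    have hins : G.IsIndepSet (insert x I : Finset V) := by
      rw [Finset.coe_insert]
      exact hind.insert fun v hv _ => ⟨fun h => (hxI v hv).2 h.symm, (hxI v hv).2⟩
    have hxmem := hI.le_of_ge ⟨Finset.insert_subset hx hIL, hins⟩ (Finset.subset_insert x I)
      (Finset.mem_insert_self x I)
    exact (hxI x hxmem).1 rfl
  refine ⟨I, hIL, hind, (Finset.card_le_card hcover).trans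
    (Finset.card_biUnion_le_card_mul _ _ _ fun v hv => (Finset.card_insert_le _ _).trans ?_)⟩
  simpa using hL v (hIL hv)

theorem card_le_two_mul_card_degree_le {c : ℕ} (hc : G.edgeFinset.card ≤ c * Fintype.card V) :
    Fintype.card V ≤ 2 * (Finset.univ.filter fun v => G.degree v ≤ 4 * c).card := by
  set high := Finset.univ.filter fun v => ¬ G.degree v ≤ 4 * c
  have hhigh : high.card * (4 * c + 1) ≤ 2 * (c * Fintype.card V) :=
    calc high.card * (4 * c + 1) ≤ ∑ v ∈ high, G.degree v := by
          rw [← smul_eq_mul]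
          refine Finset.card_nsmul_le_sum _ _ _ fun v hv => ?_
          exact Nat.succ_le_of_lt (not_le.1 (Finset.mem_filter.1 hv).2)
      _ ≤ ∑ v, G.degree v := Finset.sum_le_sum_of_subset (Finset.filter_subset _ _)
      _ = 2 * G.edgeFinset.card := G.sum_degrees_eq_twice_card_edges
      _ ≤ 2 * (c * Fintype.card V) := by gcongr
  have hsplit : (Finset.univ.filter fun v => G.degree v ≤ 4 * c).card + high.card =
      Fintype.card V := Finset.card_filter_add_card_filter_not _
  nlinarith

theorem exists_isIndepSet_degree_le {c : ℕ} (hc : G.edgeFinset.card ≤ c * Fintype.card V) :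
    ∃ I : Finset V, G.IsIndepSet (I : Set V) ∧ (∀ v ∈ I, G.degree v ≤ 4 * c) ∧
      Fintype.card V ≤ 2 * (4 * c + 1) * I.card := by
  obtain ⟨I, hIL, hind, hI⟩ := exists_isIndepSet_subset_card_le G
    (L := Finset.univ.filter fun v => G.degree v ≤ 4 * c) fun v hv => (Finset.mem_filter.1 hv).2
  refine ⟨I, hind, fun v hv => (Finset.mem_filter.1 (hIL hv)).2, ?_⟩
  linarith [card_le_two_mul_card_degree_le G hc]

end IndependentSets

section BallFamilies

variable {V ι : Type*} {G : SimpleGraph V} {ρ : ℕ} {o : ι → V} {B : ι → Set V}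

/-- A family of subsets of `V` in which `B i` contains the centre `o i` and is spanned by walks of
length at most `ρ` from it. -/
structure IsBallFamily (G : SimpleGraph V) (ρ : ℕ) (o : ι → V) (B : ι → Set V) : Prop where
  center_mem : ∀ i, o i ∈ B i
  reachIn : ∀ i, ∀ x ∈ B i, ReachIn G (B i) ρ (o i) x

/-- A family of pairwise disjoint sets of radius at most `ρ`, as in a model of a depth-`ρ` minor. -/
structure IsBallPacking (G : SimpleGraph V) (ρ : ℕ) (o : ι → V) (B : ι → Set V) : Prop
    extends IsBallFamily G ρ o B where
  pairwise_disjoint : Pairwise (Function.onFun Disjoint B)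

/-- The graph on the indices of a family of sets in which two indices are adjacent when some edge of
`G` joins their sets: for a ball packing, the largest minor that it models. -/
def touchGraph (G : SimpleGraph V) (B : ι → Set V) : SimpleGraph ι where
  Adj i j := i ≠ j ∧ ∃ x ∈ B i, ∃ y ∈ B j, G.Adj x y
  symm := ⟨fun _ _ ⟨hne, x, hx, y, hy, h⟩ => ⟨hne.symm, y, hy, x, hx, h.symm⟩⟩
  loopless := ⟨fun _ h => h.1 rfl⟩

theorem touchGraph_mono {B' : ι → Set V} (h : B ≤ B') : touchGraph G B ≤ touchGraph G B' :=
  fun i j ⟨hij, x, hx, y, hy, hxy⟩ => ⟨hij, x, h i hx, y, h j hy, hxy⟩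

theorem IsBallFamily.reachIn_pair (hB : IsBallFamily G ρ o B) (i : ι) {x y : V} (hx : x ∈ B i)
    (hy : y ∈ B i) : ReachIn G (B i) (2 * ρ) x y :=
  ((hB.reachIn i x hx).symm.trans (hB.reachIn i y hy)).mono subset_rfl (by omega)

theorem IsBallFamily.mono {ρ' : ℕ} (hB : IsBallFamily G ρ o B) (hρ : ρ ≤ ρ') :
    IsBallFamily G ρ' o B :=
  ⟨hB.center_mem, fun i x hx => (hB.reachIn i x hx).mono subset_rfl hρ⟩

theorem isBallFamily_setOf_reachIn {A : ι → Set V} (hA : ∀ i, o i ∈ A i) :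
    IsBallFamily G ρ o fun i => {x | ReachIn G (A i) ρ (o i) x} where
  center_mem i := .refl (hA i) ρ
  reachIn _ _ hx := ReachIn.reachIn_setOf_reachIn hx

theorem IsBallFamily.update_union [DecidableEq ι] (hB : IsBallFamily G ρ o B) {i : ι} {P : Set V}
    (hP : ∀ z ∈ P, ReachIn G P ρ (o i) z) :
    IsBallFamily G ρ o (Function.update B i (B i ∪ P)) := by
  constructor <;> intro j <;> rcases eq_or_ne j i with rfl | hji
  · simpa using Or.inl (hB.center_mem j)
  · simpa [hji] using hB.center_mem j
  · simp only [Function.update_self]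
    rintro x (hx | hx)
    · exact (hB.reachIn j x hx).mono Set.subset_union_left le_rfl
    · exact (hP x hx).mono Set.subset_union_right le_rfl
  · simpa [hji] using hB.reachIn j

theorem IsBallPacking.eq_of_mem (hB : IsBallPacking G ρ o B) {i j : ι} {x : V} (hi : x ∈ B i)
    (hj : x ∈ B j) : i = j := by
  by_contra hij
  exact Set.disjoint_left.1 (hB.pairwise_disjoint hij) hi hj

theorem IsBallPacking.center_injective (hB : IsBallPacking G ρ o B) : Function.Injective o :=
  fun i j hij => hB.eq_of_mem (hB.center_mem i) (hij ▸ hB.center_mem j)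

theorem isBallPacking_singleton (ho : Function.Injective o) :
    IsBallPacking G ρ o fun i => {o i} where
  center_mem _ := rfl
  reachIn := by
    rintro i _ rfl
    exact .refl (Set.mem_singleton _) ρ
  pairwise_disjoint _ _ hij := by simpa using ho.ne hij

theorem IsBallPacking.sumElim {κ : Type*} {o' : κ → V} {B' : κ → Set V}
    (hB : IsBallPacking G ρ o B) (hB' : IsBallPacking G ρ o' B')
    (hBB' : ∀ i k, Disjoint (B i) (B' k)) :
    IsBallPacking G ρ (Sum.elim o o') (Sum.elim B B') where
  center_mem := by
    rintro (i | k)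
    exacts [hB.center_mem i, hB'.center_mem k]
  reachIn := by
    rintro (i | k)
    exacts [hB.reachIn i, hB'.reachIn k]
  pairwise_disjoint := by
    rintro (i | k) (j | l) hne
    · exact hB.pairwise_disjoint (fun h => hne (congrArg _ h))
    · exact hBB' i l
    · exact (hBB' j k).symm
    · exact hB'.pairwise_disjoint (fun h => hne (congrArg _ h))

end BallFamilies

section DepthMinors

theorem exists_center_of_radius_le {V : Type*} {G : SimpleGraph V} {S : G.Subgraph} {r : ℕ}
    (hconn : S.coe.Connected) (hr : S.coe.radius ≤ r) :
    ∃ o ∈ S.verts, ∀ x ∈ S.verts, ReachIn G S.verts r o x := by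
  have := hconn.nonempty
  obtain ⟨o, ho⟩ := S.coe.exists_eccent_eq_radius
  refine ⟨o, o.2, fun x hx => ?_⟩
  obtain ⟨p, hp⟩ := exists_walk_length_le_of_edist_le
    (SimpleGraph.edist_le_eccent.trans (ho.le.trans hr) : S.coe.edist o ⟨x, hx⟩ ≤ r)
  have hsupport : ∀ z ∈ (p.map S.hom).support, z ∈ S.verts := by
    simp only [SimpleGraph.Walk.support_map, List.mem_map]
    rintro _ ⟨z, -, rfl⟩
    exact z.2
  exact ⟨p.map S.hom, (p.length_map S.hom).le.trans hp, hsupport⟩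

theorem connected_radius_le_of_reachIn {V : Type*} {G : SimpleGraph V} {A : Set V} {r : ℕ} {o : V}
    (ho : o ∈ A) (hA : ∀ x ∈ A, ReachIn G A r o x) :
    ((⊤ : G.Subgraph).induce A).coe.Connected ∧ ((⊤ : G.Subgraph).induce A).coe.radius ≤ r := by
  let toSubgraph : G.induce A →g ((⊤ : G.Subgraph).induce A).coe :=
    { toFun := id
      map_rel' := fun {x y} hxy => ⟨x.2, y.2, hxy⟩ }
  let center : ((⊤ : G.Subgraph).induce A).verts := ⟨o, ho⟩
  have hwalk : ∀ x, ∃ p : ((⊤ : G.Subgraph).induce A).coe.Walk center x, p.length ≤ r := by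
    rintro ⟨x, hx⟩
    obtain ⟨p, hp, hpA⟩ := hA x hx
    have hlength := congrArg SimpleGraph.Walk.length (p.map_induce hpA)
    rw [SimpleGraph.Walk.length_map] at hlength
    exact ⟨(p.induce A hpA).map toSubgraph, by rwa [SimpleGraph.Walk.length_map, hlength]⟩
  constructor
  · rw [SimpleGraph.connected_iff_exists_forall_reachable]
    exact ⟨center, fun x => ⟨(hwalk x).choose⟩⟩
  · refine SimpleGraph.radius_le_eccent.trans ((SimpleGraph.eccent_le_iff center _).2 fun x => ?_)
    obtain ⟨p, hp⟩ := hwalk x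
    exact p.edist_le.trans (by exact_mod_cast hp)

theorem isDepthMinor_iff_exists_isBallPacking {r : ℕ} {H G : FinGraph.{u}} :
    IsDepthMinor r H G ↔ ∃ (o : H.V → G.V) (B : H.V → Set G.V),
      IsBallPacking G.graph r o B ∧ H.graph ≤ touchGraph G.graph B := by
  constructor
  · rintro ⟨branch, hbranch, hdisj, hadj⟩
    choose o ho hreach using fun a => exists_center_of_radius_le (hbranch a).1 (hbranch a).2
    exact ⟨o, fun a => (branch a).verts, ⟨⟨ho, hreach⟩, fun a b hab => hdisj a b hab⟩,
      fun a b hab => ⟨hab.ne, hadj a b hab⟩⟩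
  · rintro ⟨o, B, hB, hle⟩
    exact ⟨fun a => (⊤ : G.graph.Subgraph).induce (B a),
      fun a => connected_radius_le_of_reachIn (hB.center_mem a) (hB.reachIn a),
      fun a b hab => hB.pairwise_disjoint hab, fun a b hab => (hle hab).2⟩

theorem nabla_le_iff {r c : ℕ} {G : FinGraph.{u}} :
    nabla r G ≤ c ↔ ∀ H : FinGraph.{u}, IsDepthMinor r H G →
      H.graph.edgeSet.ncard ≤ c * Nat.card H.V := by
  refine iSup₂_le_iff.trans (forall₂_congr fun H _ => ?_)
  rw [edgeDensity, ENNReal.div_le_iff_le_mul (Or.inr (by simp)) (Or.inl (by simp))]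
  exact_mod_cast Iff.rfl

theorem boundedExpansion_iff {C : Set FinGraph.{u}} :
    BoundedExpansion C ↔ ∀ r, ∃ c : ℕ, ∀ G ∈ C, nabla r G ≤ c := by
  refine forall_congr' fun r => ⟨fun h => ?_, fun ⟨c, hc⟩ => ?_⟩
  · obtain ⟨c, hc⟩ := ENNReal.exists_nat_gt h.ne
    exact ⟨c, fun G hG => (le_iSup₂ (f := fun G (_ : G ∈ C) => nabla r G) G hG).trans hc.le⟩
  · exact (iSup₂_le hc).trans_lt (ENNReal.natCast_lt_top c)

/-- The depth-`ρ` minors of `G` have at most `c` times as many edges as vertices, stated for the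
touching graphs of ball packings so that it applies to graphs that are not bundled. -/
def SparseAt {V : Type u} (G : SimpleGraph V) (ρ c : ℕ) : Prop :=
  ∀ (ι : Type u) [Finite ι] (o : ι → V) (B : ι → Set V), IsBallPacking G ρ o B →
    (touchGraph G B).edgeSet.ncard ≤ c * Nat.card ι

theorem sparseAt_of_nabla_le {G : FinGraph.{u}} {ρ c : ℕ} (h : nabla ρ G ≤ c) :
    SparseAt G.graph ρ c := fun ι _ o B hB =>
  nabla_le_iff.1 h ⟨ι, touchGraph G.graph B⟩
    (isDepthMinor_iff_exists_isBallPacking.2 ⟨o, B, hB, le_rfl⟩)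

theorem SparseAt.mono {V : Type u} {G : SimpleGraph V} {ρ ρ' c : ℕ} (hG : SparseAt G ρ c)
    (hρ : ρ' ≤ ρ) : SparseAt G ρ' c := fun ι _ o B hB =>
  hG ι o B ⟨hB.toIsBallFamily.mono hρ, hB.pairwise_disjoint⟩

theorem SparseAt.sum_ncard_neighbors_le {V κ : Type u} [Finite V] [Fintype κ] {G : SimpleGraph V}
    {ρ c : ℕ} (hG : SparseAt G ρ c) {o : κ → V} {T : κ → Set V} (hT : IsBallPacking G ρ o T)
    {M : Set V} (hTM : ∀ k, Disjoint (T k) M) :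
    ∑ k, {m ∈ M | ∃ x ∈ T k, G.Adj x m}.ncard ≤ c * (Fintype.card κ + M.ncard) := by
  have hpacking := hT.sumElim (isBallPacking_singleton (o := ((↑) : M → V)) Subtype.val_injective)
    fun k m => Set.disjoint_singleton_right.2 (Set.disjoint_right.1 (hTM k) m.2)
  let edge : (Σ k, {m ∈ M | ∃ x ∈ T k, G.Adj x m}) →
      (touchGraph G (Sum.elim T fun m : M => {(m : V)})).edgeSet := fun e =>
    ⟨s(.inl e.1, .inr ⟨e.2, e.2.2.1⟩), by
      obtain ⟨k, m, hm, x, hx, hxm⟩ := e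
      exact ⟨Sum.inl_ne_inr, x, hx, m, rfl, hxm⟩⟩
  have hedge : Function.Injective edge := by
    rintro ⟨k, m, hm⟩ ⟨k', m', hm'⟩ h
    obtain ⟨rfl, rfl⟩ : k = k' ∧ m = m' := by simpa [edge] using h
    rfl
  calc ∑ k, {m ∈ M | ∃ x ∈ T k, G.Adj x m}.ncard
      = Nat.card (Σ k, {m ∈ M | ∃ x ∈ T k, G.Adj x m}) := by
        simp only [Nat.card_sigma, Nat.card_coe_set_eq]
    _ ≤ (touchGraph G (Sum.elim T fun m : M => {(m : V)})).edgeSet.ncard := by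
        rw [← Nat.card_coe_set_eq]
        exact Nat.card_le_card_of_injective edge hedge
    _ ≤ c * (Fintype.card κ + M.ncard) := by
        simpa [Nat.card_sum] using hG (κ ⊕ M) _ _ hpacking

end DepthMinors

section SaturatedPackings

variable {V ι : Type*} {G : SimpleGraph V} {U A : Set V} {m n : ℕ} {u v : V}

/-- The vertices reached from `v` by walks of length at most `n` that avoid `U`, except in `v`. -/
def avoidingBall (G : SimpleGraph V) (U : Set V) (n : ℕ) (v : V) : Set V :=
  {x | ReachIn G (insert v Uᶜ) n v x}

/-- The vertices of `U` in which a walk of length at most `n + 1` from `v` can meet `U` for the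
first time after leaving `v`. -/
def avoidingBoundary (G : SimpleGraph V) (U : Set V) (n : ℕ) (v : V) : Set V :=
  {z ∈ U | z ≠ v ∧ ∃ x ∈ avoidingBall G U n v, G.Adj x z}

theorem avoidingBoundary_mono (hmn : m ≤ n) : avoidingBoundary G U m v ⊆ avoidingBoundary G U n v :=
  fun _ ⟨hz, hzv, x, hx, hxz⟩ => ⟨hz, hzv, x, ReachIn.mono hx subset_rfl hmn, hxz⟩

theorem exists_mem_support_mem_avoidingBoundary (p : G.Walk v u) (hu : u ∈ U) (huv : u ≠ v)
    (hp : p.length ≤ n + 1) : ∃ z ∈ p.support, z ∈ avoidingBoundary G U n v := by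
  obtain ⟨k, x, z, hk, hx, hxz, hz, hzp⟩ := exists_first_exit p (Set.mem_insert v Uᶜ)
    (by simpa [huv] using hu : u ∉ insert v Uᶜ)
  simp only [Set.mem_insert_iff, Set.mem_compl_iff, not_or, not_not] at hz
  exact ⟨z, hzp, hz.2, hz.1, x, hx.mono subset_rfl (by omega), hxz⟩

theorem mem_avoidingBoundary_of_not_disjoint (hv : v ∈ U) (huv : u ≠ v)
    (h : ¬ Disjoint (avoidingBall G U n u) (avoidingBall G U n v)) :
    v ∈ avoidingBoundary G U (2 * n) u := by
  obtain ⟨x, hxu, hxv⟩ := Set.not_disjoint_iff.1 h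
  have hxu : ReachIn G (insert u Uᶜ) n u x := hxu
  have hxv : ReachIn G (insert v Uᶜ) n v x := hxv
  obtain ⟨p, hp, hpU⟩ := (hxu.mono (Set.subset_union_left (t := insert v Uᶜ)) le_rfl).trans
    (hxv.symm.mono (Set.subset_union_right (s := insert u Uᶜ)) le_rfl)
  obtain ⟨z, hzp, hz⟩ := exists_mem_support_mem_avoidingBoundary p hv huv.symm
    (n := 2 * n) (by omega)
  obtain rfl : z = v := by simpa [hz.1, hz.2.1] using hpU z hzp
  exact hz

/-- A ball packing none of whose sets can be extended by a walk that avoids the packing so as to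
touch the centre of a set which it did not touch before. -/
structure IsSaturatedPacking (G : SimpleGraph V) (ρ : ℕ) (o : ι → V) (B : ι → Set V) : Prop
    extends IsBallPacking G ρ o B where
  touch : ∀ i j, o j ∈ avoidingBoundary G (⋃ k, B k) ρ (o i) → (touchGraph G B).Adj i j

variable {ρ : ℕ} {o : ι → V} {B : ι → Set V}

theorem IsBallPacking.update_union [DecidableEq ι] (hB : IsBallPacking G ρ o B) {i : ι}
    {P : Set V} (hPU : P ⊆ insert (o i) (⋃ k, B k)ᶜ) (hP : ∀ z ∈ P, ReachIn G P ρ (o i) z) :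
    IsBallPacking G ρ o (Function.update B i (B i ∪ P)) := by
  refine ⟨hB.toIsBallFamily.update_union hP, ?_⟩
  have hdisj : ∀ j, j ≠ i → Disjoint (B i ∪ P) (B j) := by
    refine fun j hji => Disjoint.sup_left (hB.pairwise_disjoint hji.symm)
      (Set.disjoint_left.2 fun z hzP hzj => ?_)
    rcases hPU hzP with rfl | hz
    · exact hji (hB.eq_of_mem hzj (hB.center_mem i))
    · exact hz (Set.mem_iUnion_of_mem j hzj)
  intro j k hjk
  rcases eq_or_ne j i with rfl | hji
  · simpa [Function.onFun, hjk.symm] using hdisj k hjk.symm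
  rcases eq_or_ne k i with rfl | hki
  · simpa [Function.onFun, hji] using (hdisj j hji).symm
  · simpa [Function.onFun, hji, hki] using hB.pairwise_disjoint hjk

theorem IsBallPacking.exists_touchGraph_lt [Finite V] (hB : IsBallPacking G ρ o B) {i j : ι}
    (hij : o j ∈ avoidingBoundary G (⋃ k, B k) ρ (o i)) (hnadj : ¬ (touchGraph G B).Adj i j) :
    ∃ B', IsBallPacking G ρ o B' ∧ touchGraph G B < touchGraph G B' ∧
      ((⋃ k, B' k) \ Set.range o).ncard ≤ ((⋃ k, B k) \ Set.range o).ncard + ρ := by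
  classical
  obtain ⟨-, hne, y, hy, hyj⟩ := hij
  obtain ⟨P, hPU, hyP, hP, hPcard⟩ := ReachIn.exists_subset_ncard_diff_le hy
  set B' := Function.update B i (B i ∪ P) with hB'
  have hle : B ≤ B' := le_update_iff.2 ⟨Set.subset_union_left, fun _ _ => le_rfl⟩
  have hadj : (touchGraph G B').Adj i j :=
    ⟨fun h => hne (h ▸ rfl), y, by simp [hB', hyP], o j, hle j (hB.center_mem j), hyj⟩
  have hunion : (⋃ k, B' k) \ Set.range o ⊆ ((⋃ k, B k) \ Set.range o) ∪ (P \ {o i}) := by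
    rintro x ⟨hx, hxo⟩
    obtain ⟨k, hk⟩ := Set.mem_iUnion.1 hx
    have hxBP : x ∈ ⋃ k, B k ∨ x ∈ P := by
      rcases eq_or_ne k i with rfl | hki
      · rw [hB', Function.update_self] at hk
        exact hk.imp_left (Set.mem_iUnion_of_mem k)
      · rw [hB', Function.update_of_ne hki] at hk
        exact .inl (Set.mem_iUnion_of_mem k hk)
    exact hxBP.imp (fun h => ⟨h, hxo⟩) fun h => ⟨h, fun hxi => hxo ⟨i, hxi.symm⟩⟩
  refine ⟨B', hB.update_union hPU hP,
    lt_of_le_not_ge (touchGraph_mono hle) fun h => hnadj (h hadj), ?_⟩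
  exact (Set.ncard_le_ncard hunion (Set.toFinite _)).trans
    ((Set.ncard_union_le _ _).trans (by gcongr))

theorem exists_isSaturatedPacking [Finite V] [Finite ι] (G : SimpleGraph V) (ρ : ℕ)
    (ho : Function.Injective o) :
    ∃ B, IsSaturatedPacking G ρ o B ∧
      ((⋃ k, B k) \ Set.range o).ncard ≤ ρ * (touchGraph G B).edgeSet.ncard := by
  let economical : Set (ι → Set V) := {B | IsBallPacking G ρ o B ∧
    ((⋃ k, B k) \ Set.range o).ncard ≤ ρ * (touchGraph G B).edgeSet.ncard}
  have hne : economical.Nonempty :=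
    ⟨fun i => {o i}, isBallPacking_singleton ho, by simp [Set.iUnion_singleton_eq_range]⟩
  obtain ⟨B, ⟨hB, hBcard⟩, hmax⟩ := Set.exists_max_image economical
    (fun B => (touchGraph G B).edgeSet.ncard) (Set.toFinite _) hne
  refine ⟨B, ⟨hB, fun i j hij => ?_⟩, hBcard⟩
  by_contra hnadj
  obtain ⟨B', hB', hlt, hcard⟩ := hB.exists_touchGraph_lt hij hnadj
  have hedges : (touchGraph G B).edgeSet.ncard < (touchGraph G B').edgeSet.ncard :=
    Set.ncard_lt_ncard (SimpleGraph.edgeSet_ssubset_edgeSet.2 hlt) (Set.toFinite _)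
  have hB'mem : B' ∈ economical := ⟨hB', by nlinarith⟩
  exact (hmax B' hB'mem).not_gt hedges

theorem IsSaturatedPacking.ncard_avoidingBoundary_inter_le [Fintype ι]
    [DecidableRel (touchGraph G B).Adj] (hB : IsSaturatedPacking G ρ o B) (hn : n ≤ ρ) (i : ι) :
    (avoidingBoundary G (⋃ k, B k) n (o i) ∩ Set.range o).ncard ≤ (touchGraph G B).degree i := by
  have hsub : avoidingBoundary G (⋃ k, B k) n (o i) ∩ Set.range o ⊆
      o '' (touchGraph G B).neighborFinset i := by
    rintro _ ⟨hj, j, rfl⟩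
    exact ⟨j, by simpa using hB.touch i j (avoidingBoundary_mono hn hj), rfl⟩
  calc _ ≤ (o '' (touchGraph G B).neighborFinset i).ncard :=
        Set.ncard_le_ncard hsub (Set.toFinite _)
    _ ≤ ((touchGraph G B).neighborFinset i : Set ι).ncard := Set.ncard_image_le (Set.toFinite _)
    _ = (touchGraph G B).degree i := by
        rw [Set.ncard_coe_finset, SimpleGraph.card_neighborFinset_eq_degree]

theorem IsSaturatedPacking.isBallPacking_avoidingBall (hB : IsSaturatedPacking G (2 * n) o B)
    {I : Set ι} (hI : (touchGraph G B).IsIndepSet I) :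
    IsBallPacking G n (fun i : I => o i) fun i : I => avoidingBall G (⋃ k, B k) n (o i) where
  toIsBallFamily := isBallFamily_setOf_reachIn fun i => Set.mem_insert (o i) _
  pairwise_disjoint i j hij := by
    by_contra hdisj
    have hne : (i : ι) ≠ j := fun h => hij (Subtype.ext h)
    exact hI i.2 j.2 hne (hB.touch i j (mem_avoidingBoundary_of_not_disjoint
      (Set.mem_iUnion_of_mem (j : ι) (hB.center_mem j)) (hB.center_injective.ne hne) hdisj))

theorem IsSaturatedPacking.sum_ncard_avoidingBoundary_diff_le {V ι : Type u} [Finite V]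
    {G : SimpleGraph V} {o : ι → V} {B : ι → Set V} {c : ℕ} (hG : SparseAt G n c)
    (hB : IsSaturatedPacking G (2 * n) o B) {I : Finset ι}
    (hI : (touchGraph G B).IsIndepSet (I : Set ι)) :
    ∑ i ∈ I, (avoidingBoundary G (⋃ k, B k) n (o i) \ Set.range o).ncard ≤
      c * (I.card + ((⋃ k, B k) \ Set.range o).ncard) := by
  set M := (⋃ k, B k) \ Set.range o
  have hdisj : ∀ i : I, Disjoint (avoidingBall G (⋃ k, B k) n (o i)) M := fun i =>
    Set.disjoint_left.2 fun x hx hxM =>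
      (ReachIn.right_mem hx).elim (fun h => hxM.2 ⟨i, h.symm⟩) fun h => h hxM.1
  have hsub : ∀ i, avoidingBoundary G (⋃ k, B k) n (o i) \ Set.range o ⊆
      {m ∈ M | ∃ x ∈ avoidingBall G (⋃ k, B k) n (o i), G.Adj x m} :=
    fun i z ⟨⟨hzU, _, hz⟩, hzo⟩ => ⟨⟨hzU, hzo⟩, hz⟩
  have hsum := hG.sum_ncard_neighbors_le (hB.isBallPacking_avoidingBall hI) hdisj
  rw [← Nat.card_eq_fintype_card, Nat.card_coe_set_eq, Set.ncard_coe_finset] at hsum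
  refine le_trans ?_ hsum
  rw [← Finset.sum_coe_sort]
  exact Finset.sum_le_sum fun i _ => Set.ncard_le_ncard (hsub i) (Set.toFinite _)

end SaturatedPackings

section Separators

/-- `Z` avoids `v` and meets every walk of length at most `r` from `v` to another vertex of `S`. -/
def IsShortWalkSeparator {V : Type*} (G : SimpleGraph V) (r : ℕ) (v : V) (S Z : Set V) : Prop :=
  v ∉ Z ∧ ∀ u ∈ S, u ≠ v → ∀ p : G.Walk v u, p.length ≤ r → ∃ z ∈ Z, z ∈ p.support

/-- The size of the separators of `SparseAt.exists_isShortWalkSeparator`: at most `4 * c` centres of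
a saturated packing, and the other vertices of the packing that an average centre accounts for. -/
def separatorBound (r c : ℕ) : ℕ := 4 * c + c * (1 + 2 * r * c * (2 * (4 * c + 1)))

theorem SparseAt.exists_isShortWalkSeparator {V : Type u} [Finite V] {G : SimpleGraph V} {r c : ℕ}
    (hG : SparseAt G (2 * r) c) {S : Set V} (hS : S.Nonempty) :
    ∃ v ∈ S, ∃ Z : Set V, Z.ncard ≤ separatorBound r c ∧ IsShortWalkSeparator G r v S Z := by
  classical
  have := Fintype.ofFinite S
  have := hS.to_subtype
  obtain ⟨B, hB, hcard⟩ :=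
    exists_isSaturatedPacking G (2 * r) (Subtype.val_injective : Function.Injective ((↑) : S → V))
  set U := ⋃ k, B k
  set M := U \ Set.range ((↑) : S → V)
  have hedges : (touchGraph G B).edgeSet.ncard ≤ c * Fintype.card S := by
    simpa using hG S _ B hB.toIsBallPacking
  obtain ⟨I, hind, hdeg, hI⟩ := exists_isIndepSet_degree_le (touchGraph G B) (c := c)
    (by rwa [SimpleGraph.edgeFinset, ← Set.ncard_eq_toFinset_card'])
  have hIne : I.Nonempty := Finset.card_pos.1
    (pos_of_mul_pos_right (Fintype.card_pos.trans_le hI) (Nat.zero_le _))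
  have hM : M.ncard ≤ 2 * r * c * (2 * (4 * c + 1)) * I.card :=
    calc M.ncard ≤ 2 * r * (touchGraph G B).edgeSet.ncard := hcard
      _ ≤ 2 * r * (c * (2 * (4 * c + 1) * I.card)) := by gcongr; exact hedges.trans (by gcongr)
      _ = _ := by ring
  have hsum : ∑ v ∈ I, (avoidingBoundary G U r v \ Set.range ((↑) : S → V)).ncard ≤
      ∑ _v ∈ I, c * (1 + 2 * r * c * (2 * (4 * c + 1))) :=
    calc _ ≤ c * (I.card + M.ncard) :=
          hB.sum_ncard_avoidingBoundary_diff_le (hG.mono (by omega)) hind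
      _ ≤ c * (I.card + 2 * r * c * (2 * (4 * c + 1)) * I.card) := by gcongr
      _ = _ := by rw [Finset.sum_const, smul_eq_mul]; ring
  obtain ⟨v, hv, hvle⟩ := Finset.exists_le_of_sum_le hIne hsum
  refine ⟨v, v.2, avoidingBoundary G U r v, ?_, fun h => h.2.1 rfl, fun u hu huv p hp => ?_⟩
  · rw [← Set.ncard_inter_add_ncard_sdiff_eq_ncard _ (Set.range ((↑) : S → V)) (Set.toFinite _)]
    exact Nat.add_le_add ((hB.ncard_avoidingBoundary_inter_le (by omega) v).trans (hdeg v hv)) hvle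
  · have huU : u ∈ U := Set.mem_iUnion_of_mem ⟨u, hu⟩ (hB.center_mem ⟨u, hu⟩)
    obtain ⟨z, hzp, hz⟩ := exists_mem_support_mem_avoidingBoundary p huU huv (n := r) (by omega)
    exact ⟨z, hz, hzp⟩

end Separators

section WeakReachability

/-- The vertices weakly `n`-reachable from `v` with respect to the ranking `π`: those that have the
smallest rank on some walk of length at most `n` from `v` to them. -/
def weakReach {V α : Type*} [LE α] (G : SimpleGraph V) (π : V → α) (n : ℕ) (v : V) : Set V :=
  {u | ReachIn G {z | π u ≤ π z} n v u}

theorem exists_ranking {V : Type*} [Finite V] {P : V → Set V → Prop}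
    (hP : ∀ S : Set V, S.Nonempty → ∃ v ∈ S, P v S) :
    ∃ π : V → ℕ, ∀ v, P v {u | π u ≤ π v} := by
  classical
  suffices h : ∀ S : Set V, ∃ π : V → ℕ, ∀ v ∈ S, P v {u ∈ S | π u ≤ π v} by
    simpa using h Set.univ
  intro S
  induction S using WellFoundedLT.induction with
  | ind S ih =>
    rcases S.eq_empty_or_nonempty with rfl | hS
    · exact ⟨fun _ => 0, by simp⟩
    obtain ⟨v, hvS, hv⟩ := hP S hS
    obtain ⟨π, hπ⟩ := ih (S \ {v}) (Set.sdiff_singleton_ssubset.2 hvS)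
    obtain ⟨b, hb⟩ := (Set.toFinite (Set.range π)).bddAbove
    have hle : ∀ u, π u ≤ b := fun u => hb ⟨u, rfl⟩
    refine ⟨Function.update π v (b + 1), fun a ha => ?_⟩
    rcases eq_or_ne a v with rfl | hav
    · convert hv using 1
      ext u
      rcases eq_or_ne u a with rfl | hu
      · simp
      · simpa [hu] using fun _ => (hle u).trans (Nat.le_succ b)
    · convert hπ a ⟨ha, hav⟩ using 1
      ext u
      rcases eq_or_ne u v with rfl | hu
      · simpa [hav] using fun _ => Nat.lt_succ_of_le (hle a)
      · simp [hu, hav]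

theorem ncard_weakReach_le {V α : Type*} [Finite V] [LE α] {G : SimpleGraph V} {π : V → α}
    {r K : ℕ} (hπ : ∀ v, ∃ Z : Set V, Z.ncard ≤ K ∧ IsShortWalkSeparator G r v {u | π u ≤ π v} Z)
    {n : ℕ} (hn : n ≤ r) (v : V) :
    (weakReach G π n v).ncard ≤ ∑ i ∈ Finset.range (n + 1), K ^ i := by
  classical
  induction n generalizing v with
  | zero =>
    have hsub : weakReach G π 0 v ⊆ {v} := by
      rintro u ⟨p, hp, -⟩
      exact (SimpleGraph.Walk.eq_of_length_eq_zero (Nat.le_zero.1 hp)).symm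
    simpa using Set.ncard_le_ncard hsub (Set.toFinite _)
  | succ n ih =>
    obtain ⟨Z, hZK, hvZ, hZ⟩ := hπ v
    have hsub : weakReach G π (n + 1) v ⊆ (⋃ z ∈ Z, weakReach G π n z) ∪ {v} := by
      rintro u ⟨p, hp, hpu⟩
      rcases eq_or_ne u v with rfl | huv
      · exact .inr rfl
      obtain ⟨z, hzZ, hzp⟩ := hZ u (hpu v p.start_mem_support) huv p (hp.trans hn)
      have hlength : (p.takeUntil z hzp).length + (p.dropUntil z hzp).length = p.length := by
        rw [← SimpleGraph.Walk.length_append, SimpleGraph.Walk.take_spec]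
      have hpos : (p.takeUntil z hzp).length ≠ 0 := fun h =>
        hvZ ((SimpleGraph.Walk.eq_of_length_eq_zero h).symm ▸ hzZ)
      exact .inl (Set.mem_biUnion hzZ ⟨p.dropUntil z hzp, by omega, fun w hw =>
        hpu w (p.support_dropUntil_subset_support hzp hw)⟩)
    calc (weakReach G π (n + 1) v).ncard
        ≤ (⋃ z ∈ Z, weakReach G π n z).ncard + ({v} : Set V).ncard :=
          (Set.ncard_le_ncard hsub (Set.toFinite _)).trans (Set.ncard_union_le _ _)
      _ ≤ Z.ncard * ∑ i ∈ Finset.range (n + 1), K ^ i + 1 := by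
          rw [Set.ncard_singleton]
          gcongr
          exact ncard_biUnion_le_mul (Set.toFinite _) fun z _ => ih (by omega) z
      _ ≤ K * ∑ i ∈ Finset.range (n + 1), K ^ i + 1 := by gcongr
      _ = ∑ i ∈ Finset.range (n + 1 + 1), K ^ i := geom_sum_succ.symm

theorem BoundedExpansion.exists_ncard_weakReach_le {C : Set FinGraph.{u}} (hC : BoundedExpansion C)
    (r : ℕ) : ∃ N : ℕ, ∀ G ∈ C, ∃ π : G.V → ℕ, ∀ v, (weakReach G.graph π r v).ncard ≤ N := by
  obtain ⟨c, hc⟩ := boundedExpansion_iff.1 hC (2 * r)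
  refine ⟨∑ i ∈ Finset.range (r + 1), separatorBound r c ^ i, fun G hG => ?_⟩
  obtain ⟨π, hπ⟩ := exists_ranking fun S hS =>
    (sparseAt_of_nabla_le (hc G hG)).exists_isShortWalkSeparator hS
  exact ⟨π, ncard_weakReach_le hπ le_rfl⟩

end WeakReachability

section CongestedMinors

variable {V ι κ : Type*} {G : SimpleGraph V} {Q : SimpleGraph ι} {K : SimpleGraph κ}
  {r s t t' N : ℕ}

/-- `H` is a depth-`s` minor of `G` with congestion `t`: the sets representing its vertices may
overlap, but each vertex of `G` lies in at most `t` of them, and adjacent vertices of `H` may be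
represented by sets that meet instead of being joined by an edge. -/
def IsCongestedMinor (s t : ℕ) (H : SimpleGraph ι) (G : SimpleGraph V) : Prop :=
  ∃ (o : ι → V) (B : ι → Set V), IsBallFamily G s o B ∧
    (∀ i j, H.Adj i j → ∃ x ∈ B i, ∃ y ∈ B j, G.edist x y ≤ 1) ∧
    ∀ v, {i | v ∈ B i}.ncard ≤ t

theorem IsDepthMinor.isCongestedMinor {H G : FinGraph.{u}} (h : IsDepthMinor r H G) :
    IsCongestedMinor r 1 H.graph G.graph := by
  obtain ⟨o, B, hB, hle⟩ := isDepthMinor_iff_exists_isBallPacking.1 h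
  refine ⟨o, B, hB.toIsBallFamily, fun a b hab => ?_, fun v => ?_⟩
  · obtain ⟨-, x, hx, y, hy, hxy⟩ := hle hab
    exact ⟨x, hx, y, hy, SimpleGraph.edist_le_one_iff_adj_or_eq.2 (.inl hxy)⟩
  · exact (Set.ncard_le_one (Set.toFinite _)).2 fun a ha b hb => hB.eq_of_mem ha hb

theorem IsBallFamily.reachIn_biUnion {o : ι → V} {B : ι → Set V} (hB : IsBallFamily G s o B)
    (hadj : ∀ i j, Q.Adj i j → ∃ x ∈ B i, ∃ y ∈ B j, G.edist x y ≤ 1) {A : Set ι} {i j : ι}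
    (h : ReachIn Q A r i j) : ReachIn G (⋃ k ∈ A, B k) (r * (2 * s + 1)) (o i) (o j) := by
  have hsub : ∀ k ∈ A, B k ⊆ ⋃ k ∈ A, B k := fun k hk => Set.subset_biUnion_of_mem hk
  obtain ⟨p, hp, hpA⟩ := h
  suffices h : ReachIn G (⋃ k ∈ A, B k) (p.length * (2 * s + 1)) (o i) (o j) from
    h.mono subset_rfl (by gcongr)
  clear hp
  induction p with
  | @nil i => exact .refl (hsub i (hpA i (by simp)) (hB.center_mem i)) _
  | @cons i k j hik q ih =>
    obtain ⟨x, hx, y, hy, hxy⟩ := hadj i k hik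
    have hi := hsub i (hpA i (by simp))
    have hk := hsub k (hpA k (by simp))
    have hstep : ReachIn G (⋃ k ∈ A, B k) (s + 1 + s) (o i) (o k) :=
      (((hB.reachIn i x hx).mono hi le_rfl).trans (.of_edist_le_one hxy (hi hx) (hk hy))).trans
        ((hB.reachIn k y hy).symm.mono hk le_rfl)
    refine (hstep.trans (ih fun z hz => hpA z (by simp [hz]))).mono subset_rfl ?_
    rw [SimpleGraph.Walk.length_cons]
    linarith

theorem IsCongestedMinor.trans [Finite ι] [Finite κ] (hK : IsCongestedMinor r t' K Q)
    (hQ : IsCongestedMinor s t Q G) :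
    IsCongestedMinor (s + r * (2 * s + 1)) (t * t') K G := by
  obtain ⟨c, A, hA, hKadj, hAt⟩ := hK
  obtain ⟨o, B, hB, hQadj, hBt⟩ := hQ
  refine ⟨o ∘ c, fun a => ⋃ i ∈ A a, B i, ⟨fun a => ?_, fun a x hx => ?_⟩, fun a b hab => ?_,
    fun v => ?_⟩
  · exact Set.mem_biUnion (hA.center_mem a) (hB.center_mem (c a))
  · obtain ⟨i, hi, hx⟩ := Set.mem_iUnion₂.1 hx
    exact ((hB.reachIn_biUnion hQadj (hA.reachIn a i hi)).trans
      ((hB.reachIn i x hx).mono (Set.subset_biUnion_of_mem hi) le_rfl)).mono subset_rfl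
        (Nat.add_comm _ _).le
  · obtain ⟨i, hi, j, hj, hij⟩ := hKadj a b hab
    rcases SimpleGraph.edist_le_one_iff_adj_or_eq.1 hij with hij | rfl
    · obtain ⟨x, hx, y, hy, hxy⟩ := hQadj i j hij
      exact ⟨x, Set.mem_biUnion hi hx, y, Set.mem_biUnion hj hy, hxy⟩
    · exact ⟨o i, Set.mem_biUnion hi (hB.center_mem i), o i, Set.mem_biUnion hj (hB.center_mem i),
        by simp⟩
  · have hsub : {a | v ∈ ⋃ i ∈ A a, B i} ⊆ ⋃ i ∈ {i | v ∈ B i}, {a | i ∈ A a} := by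
      intro a ha
      obtain ⟨i, hi, hv⟩ := Set.mem_iUnion₂.1 ha
      exact Set.mem_biUnion (show i ∈ {i | v ∈ B i} from hv) hi
    calc {a | v ∈ ⋃ i ∈ A a, B i}.ncard ≤ _ := Set.ncard_le_ncard hsub (Set.toFinite _)
      _ ≤ {i | v ∈ B i}.ncard * t' := ncard_biUnion_le_mul (Set.toFinite _) fun i _ => hAt i
      _ ≤ t * t' := by gcongr; exact hBt v

theorem IsCongestedMinor.ncard_edgeSet_le {α : Type*} [LinearOrder α] [Finite V] [Finite κ]
    (hK : IsCongestedMinor s t K G) {π : V → α}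
    (hπ : ∀ v, (weakReach G π (4 * s + 1) v).ncard ≤ N) :
    K.edgeSet.ncard ≤ N * t * Nat.card κ := by
  obtain ⟨o, B, hB, hadj, ht⟩ := hK
  have hexists : ∀ a, ∃ m ∈ B a, ∀ x ∈ B a, π m ≤ π x := fun a =>
    Set.exists_min_image (B a) π (Set.toFinite _) ⟨o a, hB.center_mem a⟩
  choose m hmB hmin using hexists
  have hreach : ∀ a b, K.Adj a b → ReachIn G (B a ∪ B b) (4 * s + 1) (m a) (m b) := by
    intro a b hab
    obtain ⟨x, hx, y, hy, hxy⟩ := hadj a b hab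
    exact ((((hB.reachIn_pair a (hmB a) hx).mono Set.subset_union_left le_rfl).trans
      (.of_edist_le_one hxy (.inl hx) (.inr hy))).trans
        ((hB.reachIn_pair b hy (hmB b)).mono Set.subset_union_right le_rfl)).mono subset_rfl
          (by omega)
  have hweak : ∀ a b, K.Adj a b → π (m b) ≤ π (m a) → m b ∈ weakReach G π (4 * s + 1) (m a) := by
    refine fun a b hab hle => (hreach a b hab).mono ?_ le_rfl
    rintro z (hz | hz)
    exacts [hle.trans (hmin a z hz), hmin b z hz]
  refine ncard_edgeSet_le_of_orientation (R := fun a b => m b ∈ weakReach G π (4 * s + 1) (m a))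
    (fun a b hab => ?_) fun a => ?_
  · exact (le_total (π (m b)) (π (m a))).imp (hweak a b hab) (hweak b a hab.symm)
  · have hsub : {b | m b ∈ weakReach G π (4 * s + 1) (m a)} ⊆
        ⋃ u ∈ weakReach G π (4 * s + 1) (m a), {b | u ∈ B b} := fun b hb =>
      Set.mem_biUnion hb (hmB b)
    calc _ ≤ _ := Set.ncard_le_ncard hsub (Set.toFinite _)
      _ ≤ (weakReach G π (4 * s + 1) (m a)).ncard * t :=
        ncard_biUnion_le_mul (Set.toFinite _) fun u _ => ht u
      _ ≤ N * t := by gcongr; exact hπ (m a)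

theorem BoundedExpansion.of_isCongestedMinor {C D : Set FinGraph.{u}} (hC : BoundedExpansion C)
    (hD : ∀ Q ∈ D, ∃ G ∈ C, IsCongestedMinor s t Q.graph G.graph) : BoundedExpansion D := by
  refine boundedExpansion_iff.2 fun r => ?_
  obtain ⟨N, hN⟩ := hC.exists_ncard_weakReach_le (4 * (s + r * (2 * s + 1)) + 1)
  refine ⟨N * (t * 1), fun Q hQ => nabla_le_iff.2 fun K hK => ?_⟩
  obtain ⟨G, hG, hQG⟩ := hD Q hQ
  obtain ⟨π, hπ⟩ := hN G hG
  exact (hK.isCongestedMinor.trans hQG).ncard_edgeSet_le hπ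

end CongestedMinors

section Clusterings

/-- The clustering of `H` into the fibres of a map `c` that identifies only adjacent vertices. -/
def Clustering.ofFibers {V : Type u} {β : Type*} {H : SimpleGraph V} (c : V → β)
    (hc : ∀ x y, x ≠ y → c x = c y → H.Adj x y) : Clustering H where
  blocks := (Setoid.ker c).classes
  isPartition := Setoid.isPartition_classes _
  isClique := by
    rintro _ ⟨z, rfl⟩ x hx y hy hxy
    exact hc x y hxy (Eq.trans hx (Eq.symm hy))

theorem Clustering.exists_injective_ofFibers {V : Type u} {β : Type*} {H : SimpleGraph V}
    (c : V → β) (hc : ∀ x y, x ≠ y → c x = c y → H.Adj x y) :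
    ∃ o : (ofFibers c hc).blocks → β, Function.Injective o ∧ ∀ A, ∀ x ∈ A.1, c x = o A := by
  have hexists : ∀ A : (ofFibers c hc).blocks, ∃ b, A.1 = {x | c x = b} := by
    rintro ⟨_, z, rfl⟩
    exact ⟨c z, rfl⟩
  choose o ho using hexists
  exact ⟨o, fun A A' h => Subtype.ext (by rw [ho, ho, h]), fun A x hx => by rwa [ho] at hx⟩

theorem mem_weakReach_of_forall_le {V α : Type*} [LE α] {G : SimpleGraph V} {π : V → α} {k : ℕ}
    {u w x : V} (hu : G.edist x u ≤ k) (hmin : ∀ z, G.edist x z ≤ k → π u ≤ π z)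
    (hw : G.edist x w ≤ k) : u ∈ weakReach G π (2 * k) w := by
  have hball : ∀ z, G.edist x z ≤ k → ReachIn G {z | π u ≤ π z} k x z := fun z hz =>
    (reachIn_ball_of_edist_le hz).mono hmin le_rfl
  exact ((hball w hw).symm.trans (hball u hu)).mono subset_rfl (by omega)

theorem exists_clustering_isCongestedMinor {V : Type u} [Finite V] {α : Type*} [LinearOrder α]
    {G : SimpleGraph V} {π : V → α} {d t : ℕ}
    (ht : ∀ v, (weakReach G π (2 * (d / 2)) v).ncard ≤ t) :
    ∃ X : Clustering (powerGraph G d), IsCongestedMinor (2 * (d / 2)) t X.quotientGraph G := by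
  set k := d / 2
  have hleast : ∀ v, ∃ u, G.edist v u ≤ k ∧ ∀ z, G.edist v z ≤ k → π u ≤ π z := fun v =>
    Set.exists_min_image {u | G.edist v u ≤ k} π (Set.toFinite _) ⟨v, by simp⟩
  choose c hc hmin using hleast
  have hclose : ∀ x y, x ≠ y → c x = c y → (powerGraph G d).Adj x y := by
    refine fun x y hxy hcxy => ⟨hxy, ?_⟩
    calc G.edist x y ≤ G.edist x (c x) + G.edist (c x) y := G.edist_triangle
      _ ≤ k + k := add_le_add (hc x) (by rw [hcxy, SimpleGraph.edist_comm]; exact hc y)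
      _ ≤ d := by norm_cast; omega
  obtain ⟨o, hoinj, ho⟩ := Clustering.exists_injective_ofFibers c hclose
  have hball : ∀ A, ∀ x ∈ A.1, ∀ w, G.edist x w ≤ k → o A ∈ weakReach G π (2 * k) w :=
    fun A x hx w hw => ho A x hx ▸ mem_weakReach_of_forall_le (hc x) (hmin x) hw
  refine ⟨.ofFibers c hclose, o, fun A => {w | ReachIn G {z | π (o A) ≤ π z} (2 * k) (o A) w},
    isBallFamily_setOf_reachIn fun A => le_refl (π (o A)), ?_, fun w => ?_⟩
  · rintro A A' ⟨-, x, hx, y, hy, -, hxy⟩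
    obtain ⟨w', hxw', hw'y⟩ := exists_edist_le_edist_le (m := k + 1) (n := k) (z := y)
      (hxy.trans (by norm_cast; omega))
    obtain ⟨w, hxw, hww'⟩ := exists_edist_le_edist_le (m := k) (n := 1) hxw'
    rw [SimpleGraph.edist_comm] at hw'y
    exact ⟨w, (hball A x hx w hxw).symm, w', (hball A' y hy w' hw'y).symm, hww'⟩
  · exact (Set.ncard_le_ncard_of_injOn o (fun A hA => ReachIn.symm hA) hoinj.injOn
      (Set.toFinite _)).trans (ht w)

end Clusterings

end FinGraph

theorem mainTheorem2 (C : Set FinGraph.{u}) (hC : FinGraph.BoundedExpansion C) (d : ℕ) :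
    ∃ X : ∀ H : FinGraph.powerClass C d, FinGraph.Clustering (H : FinGraph.{u}).graph,
      FinGraph.BoundedExpansion
        (Set.range fun H : FinGraph.powerClass C d => (H : FinGraph.{u}).quotient (X H)) := by
  obtain ⟨t, ht⟩ := hC.exists_ncard_weakReach_le (2 * (d / 2))
  have hclustering : ∀ H : FinGraph.powerClass C d,
      ∃ X : FinGraph.Clustering (H : FinGraph.{u}).graph, ∃ G ∈ C,
        FinGraph.IsCongestedMinor (2 * (d / 2)) t X.quotientGraph G.graph := by
    rintro ⟨_, G, hG, rfl⟩
    obtain ⟨π, hπ⟩ := ht G hG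
    obtain ⟨X, hX⟩ := FinGraph.exists_clustering_isCongestedMinor hπ
    exact ⟨X, G, hG, hX⟩
  choose X hX using hclustering
  exact ⟨X, hC.of_isCongestedMinor (Set.forall_mem_range.2 hX)⟩
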